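/- Let $\alpha>1$. There is a constant $C=C(\alpha)>0$, depending only on $\alpha$, such that the following holds for every $n\ge 1$ and every function $f$ on the positive cone $\Gamma_+=\{\kappa\in\mathbb{R}^n:\kappa_i>0 \text{ for all } i\}$ that is smooth, symmetric, has $\partial f/\partial\kappa_i>0$ for each $i$, is homogeneous of degree $1$, positive, and normalised by $f(1,\dots,1)=1$. Consider the flow that moves hypersurfaces of $\mathbb{R}^{n+1}$ in the inward normal direction with speed $f(\kappa)^\alpha$, where $\kappa$ is the vector of principal curvatures. Let $\Omega_0\subset\mathbb{R}^{n+1}$ be a bounded open convex set, $M_0=\partial\Omega_0$, and suppose that $M_0$ has a flat side in a direction $z\in S^n$: there are $y_0\in M_0$ with $\langle y_0,z\rangle=h(z):=\sup\{\langle y,z\rangle:y\in\Omega_0\}$ and $r>0$ such that the open half-ball $B_r(y_0)\cap\{y:\langle y,z\rangle<h(z)\}$ is contained in $\Omega_0$. Let $\{\Omega_t\}_{0\le t\le T}$ be any generalized solution (barrier solution) of the flow starting from this region (its initial set lies between $\Omega_0$ and $\overline{\Omega_0}$), and let $M_t=\partial\Omega_t$. Then $y_0\in M_t$ for every $t\in[0,T]$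 with $t\le C(\alpha)\,r^{1+\alpha}$. Here a barrier solution is defined as follows. A smooth subsolution (supersolution) on $[a,b]$ is a family of closed sets $U(t)\subset\mathbb{R}^{n+1}$, $a\le t\le b$, with smooth boundary depending smoothly on $t$, such that at each point of $\partial U(t)$ the principal curvatures $\kappa$ lie in $\Gamma_+$ and the inward normal velocity of $\partial U(t)$ is at least (at most) $f(\kappa)^\alpha$. A family of sets $\{\Omega_t\}_{0\le t\le T}$ is a barrier solution if, for all $[a,b]\subset[0,T]$, every smooth subsolution $U$ on $[a,b]$ with $U(a)\subset\Omega_a$ has $U(t)\subset\Omega_t$ for all $t\in[a,b]$, and every smooth supersolution $U$ on $[a,b]$ with $\Omega_a\subset U(a)$ has $\Omega_t\subset U(t)$ for all $t\in[a,b]$. -/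

import Mathlib

open Set Filter Topology
open scoped ContDiff

namespace CurvatureFlow

/-- The open positive cone `Γ₊` in `ℝⁿ`. -/
def positiveCone (n : ℕ) : Set (Fin n → ℝ) := {κ | ∀ i, 0 < κ i}

/-- The standing conditions on the function `f` of the principal curvatures; the speed of the flow
is `S = f(κ) ^ α`. (For `n = 0` there is no such `f`.) -/
structure IsSpeedFunction {n : ℕ} (f : (Fin n → ℝ) → ℝ) : Prop where
  smooth : ContDiffOn ℝ ∞ f (positiveCone n)
  symmetric : ∀ κ ∈ positiveCone n, ∀ σ : Equiv.Perm (Fin n), f (fun i => κ (σ i)) = f κ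
  increasing : ∀ κ ∈ positiveCone n, ∀ i, 0 < fderiv ℝ f κ (Pi.single i 1)
  homogeneous : ∀ κ ∈ positiveCone n, ∀ c : ℝ, 0 < c → f (c • κ) = c * f κ
  positive : ∀ κ ∈ positiveCone n, 0 < f κ
  normalised : f (fun _ => 1) = 1

/-- The time slice `Ω(t)` of a subset `Ω` of space-time. -/
def slice {E : Type*} (Ω : Set (E × ℝ)) (t : ℝ) : Set E := {x | (x, t) ∈ Ω}

/-- `κ` lists the principal curvatures at `x` of the hypersurface `{ψ = ψ x}`, with respect to the
unit normal `ν = ∇ψ / |∇ψ|`, which is the outer normal of the region `{ψ ≤ ψ x}`. The second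
fundamental form is the restriction of `D²ψ / |∇ψ|` to the tangent space `ker Dψ(x)`; `κ` is its
list of eigenvalues, for an orthonormal basis `e` of eigenvectors. Where `ψ` is smooth with nonzero
gradient such a list exists, by the spectral theorem, and it is unique up to order. -/
def IsPrincipalCurvatures {n : ℕ} (ψ : EuclideanSpace ℝ (Fin (n + 1)) → ℝ)
    (x : EuclideanSpace ℝ (Fin (n + 1))) (κ : Fin n → ℝ) : Prop :=
  ∃ e : Fin n → EuclideanSpace ℝ (Fin (n + 1)),
    Orthonormal ℝ e ∧
    (∀ i, fderiv ℝ ψ x (e i) = 0) ∧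
    ∀ i j, fderiv ℝ (fderiv ℝ ψ) x (e i) (e j) / ‖fderiv ℝ ψ x‖ = if i = j then κ i else 0

/-- The velocity at `(x, t)`, in the direction of the inner unit normal `-∇ψ / |∇ψ|`, of the
boundary of the moving region `{φ(·, t) ≤ 0}`. -/
noncomputable def inwardVelocity {n : ℕ} (φ : EuclideanSpace ℝ (Fin (n + 1)) → ℝ → ℝ)
    (x : EuclideanSpace ℝ (Fin (n + 1))) (t : ℝ) : ℝ :=
  deriv (fun s => φ x s) t / ‖fderiv ℝ (fun y => φ y t) x‖

/-- Near `(x, t)`, and for times in `[a, b]`, the set `Ω` is `{φ ≤ 0}` for a smooth function `φ`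
whose spatial gradient does not vanish. -/
structure IsLocalDefiningFunction {n : ℕ} (Ω : Set (EuclideanSpace ℝ (Fin (n + 1)) × ℝ)) (a b : ℝ)
    (φ : EuclideanSpace ℝ (Fin (n + 1)) → ℝ → ℝ)
    (x : EuclideanSpace ℝ (Fin (n + 1))) (t : ℝ) : Prop where
  smooth : ∀ᶠ p in 𝓝 (x, t), ContDiffAt ℝ ∞ (fun q : EuclideanSpace ℝ (Fin (n + 1)) × ℝ => φ q.1 q.2) p
  gradient_ne_zero : fderiv ℝ (fun y => φ y t) x ≠ 0
  mem_iff : ∀ᶠ p in 𝓝[univ ×ˢ Icc a b] (x, t), p ∈ Ω ↔ φ p.1 p.2 ≤ 0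

/-- `Ω` is a family, over the time interval `[a, b]`, of closed subsets of `ℝⁿ⁺¹` with smooth
boundary depending smoothly on time, such that at each boundary point of each slice the principal
curvatures lie in the positive cone and are related to the inward normal velocity `V` by
`R V κ`. Only points of space-time over boundary points of slices are boundary points of `Ω`
relative to `ℝⁿ⁺¹ × [a, b]` (`interior_mem`): no part of the set appears or vanishes suddenly. -/
structure IsSmoothEvolution {n : ℕ} (R : ℝ → (Fin n → ℝ) → Prop) (a b : ℝ)
    (Ω : Set (EuclideanSpace ℝ (Fin (n + 1)) × ℝ)) : Prop where
  subset : Ω ⊆ univ ×ˢ Icc a b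
  closed : IsClosed Ω
  interior_mem : ∀ t ∈ Icc a b, ∀ x ∈ interior (slice Ω t), Ω ∈ 𝓝[univ ×ˢ Icc a b] (x, t)
  boundary : ∀ t ∈ Icc a b, ∀ x ∈ frontier (slice Ω t),
    ∃ φ, IsLocalDefiningFunction Ω a b φ x t ∧
      ∀ κ, IsPrincipalCurvatures (fun y => φ y t) x κ →
        κ ∈ positiveCone n ∧ R (inwardVelocity φ x t) κ

/-- Smooth admissible subsolutions on `[a, b]`: the inward velocity is at least `f(κ) ^ α`. -/
def IsSmoothSubsolution {n : ℕ} (f : (Fin n → ℝ) → ℝ) (α a b : ℝ)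
    (Ω : Set (EuclideanSpace ℝ (Fin (n + 1)) × ℝ)) : Prop :=
  IsSmoothEvolution (fun V κ => f κ ^ α ≤ V) a b Ω

/-- Smooth admissible supersolutions on `[a, b]`: the inward velocity is at most `f(κ) ^ α`. -/
def IsSmoothSupersolution {n : ℕ} (f : (Fin n → ℝ) → ℝ) (α a b : ℝ)
    (Ω : Set (EuclideanSpace ℝ (Fin (n + 1)) × ℝ)) : Prop :=
  IsSmoothEvolution (fun V κ => V ≤ f κ ^ α) a b Ω

/-- `A` is an outer barrier on the time interval `I`: every smooth subsolution that starts inside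
`A` stays inside `A`. -/
def IsOuterBarrier {n : ℕ} (f : (Fin n → ℝ) → ℝ) (α : ℝ) (I : Set ℝ)
    (A : Set (EuclideanSpace ℝ (Fin (n + 1)) × ℝ)) : Prop :=
  A ⊆ univ ×ˢ I ∧
    ∀ a b : ℝ, a < b → Icc a b ⊆ I → ∀ Ω, IsSmoothSubsolution f α a b Ω →
      slice Ω a ⊆ slice A a → ∀ t ∈ Icc a b, slice Ω t ⊆ slice A t

/-- `A` is an inner barrier on the time interval `I`: every smooth supersolution that starts
around `A` stays around `A`. -/
def IsInnerBarrier {n : ℕ} (f : (Fin n → ℝ) → ℝ) (α : ℝ) (I : Set ℝ)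
    (A : Set (EuclideanSpace ℝ (Fin (n + 1)) × ℝ)) : Prop :=
  A ⊆ univ ×ˢ I ∧
    ∀ a b : ℝ, a < b → Icc a b ⊆ I → ∀ Ω, IsSmoothSupersolution f α a b Ω →
      slice A a ⊆ slice Ω a → ∀ t ∈ Icc a b, slice A t ⊆ slice Ω t

/-- A barrier solution (generalized solution) of the flow with speed `f(κ) ^ α` on the time
interval `I` is a set that is both an outer and an inner barrier. -/
def IsBarrierSolution {n : ℕ} (f : (Fin n → ℝ) → ℝ) (α : ℝ) (I : Set ℝ)
    (A : Set (EuclideanSpace ℝ (Fin (n + 1)) × ℝ)) : Prop :=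
  IsOuterBarrier f α I A ∧ IsInnerBarrier f α I A

/-- The support function `h(z) = sup {⟨y, z⟩ : y ∈ Ω}` (used for bounded nonempty `Ω`). -/
noncomputable def supportFunction {n : ℕ} (Ω : Set (EuclideanSpace ℝ (Fin (n + 1))))
    (z : EuclideanSpace ℝ (Fin (n + 1))) : ℝ :=
  sSup ((fun y => inner ℝ y z) '' Ω)

end CurvatureFlow

/-!
Both halves of `y₀ ∈ ∂Ω_t` come from one explicit barrier each. From outside, a stationary ball is
a supersolution, and any point beyond the supporting hyperplane at `y₀` is outside some ball
around the bounded set `Ω_0`; so `Ω_t` never crosses this hyperplane. From inside, the convex caps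
`⟨x - y₀, z⟩ + τ r (‖x - y₀‖² / r²) ^ m + η ≤ 0`, with `τ` growing linearly from `1` to `2` over a
time proportional to `r ^ (1 + α)`, start inside the half-ball and come within distance `2η` of
`y₀`. At distance `ρ` from `y₀` their curvatures are of order `ρ ^ (2 m - 2)` and their inward
velocity is of order `ρ ^ (2 m)`, so they are subsolutions as soon as `m ≤ (m - 1) α`: a suitable
exponent `m` exists exactly because `1 < α`. Letting `η → 0` puts `y₀` in the closure of `Ω_t`.
-/

namespace CurvatureFlow

section SpeedFunction

lemma monotoneOn_of_fderiv_single_nonneg {ι : Type*} [Finite ι] [DecidableEq ι]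
    {f : (ι → ℝ) → ℝ} {s : Set (ι → ℝ)} (hs : Convex ℝ s)
    (hf : ∀ x ∈ s, DifferentiableAt ℝ f x)
    (hf' : ∀ x ∈ s, ∀ i, 0 ≤ fderiv ℝ f x (Pi.single i 1)) : MonotoneOn f s := by
  have := Fintype.ofFinite ι
  intro x hx y hy hxy
  obtain ⟨w, hw, hmvt⟩ :=
    domain_mvt (fun w hw => (hf w hw).hasFDerivAt.hasFDerivWithinAt) hs hx hy
  have hnonneg : 0 ≤ fderiv ℝ f w (y - x) := by
    rw [pi_eq_sum_univ' (y - x), map_sum]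
    refine Finset.sum_nonneg fun i _ => ?_
    rw [map_smul]
    exact mul_nonneg (sub_nonneg.2 (hxy i)) (hf' w (hs.segment_subset hx hy hw) i)
  linarith

variable {n : ℕ}

lemma positiveCone_eq_pi : positiveCone n = univ.pi fun _ => Ioi 0 := by
  ext κ
  simp [positiveCone]

lemma isOpen_positiveCone : IsOpen (positiveCone n) := by
  rw [positiveCone_eq_pi]
  exact isOpen_set_pi finite_univ fun _ _ => isOpen_Ioi

lemma convex_positiveCone : Convex ℝ (positiveCone n) := by
  rw [positiveCone_eq_pi]
  exact convex_pi fun _ _ => convex_Ioi 0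

namespace IsSpeedFunction

variable {f : (Fin n → ℝ) → ℝ}

lemma monotoneOn (hf : IsSpeedFunction f) : MonotoneOn f (positiveCone n) :=
  monotoneOn_of_fderiv_single_nonneg convex_positiveCone
    (fun κ hκ => (hf.smooth.contDiffAt (isOpen_positiveCone.mem_nhds hκ)).differentiableAt
      (by simp))
    fun κ hκ i => (hf.increasing κ hκ i).le

lemma apply_const (hf : IsSpeedFunction f) {c : ℝ} (hc : 0 < c) : f (fun _ => c) = c := by
  have h := hf.homogeneous (fun _ => 1) (fun _ => one_pos) c hc
  rw [hf.normalised, mul_one] at h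
  simpa only [Pi.smul_def, smul_eq_mul, mul_one] using h

lemma le_norm (hf : IsSpeedFunction f) {κ : Fin n → ℝ} (hκ : κ ∈ positiveCone n) :
    f κ ≤ ‖κ‖ := by
  refine le_of_forall_gt_imp_ge_of_dense fun c hc => ?_
  have hc0 : 0 < c := (norm_nonneg κ).trans_lt hc
  calc f κ ≤ f (fun _ => c) := hf.monotoneOn hκ (fun _ => hc0) fun i =>
        (le_abs_self _).trans ((norm_le_pi_norm κ i).trans hc.le)
    _ = c := hf.apply_const hc0

lemma mem_Icc (hf : IsSpeedFunction f) {κ : Fin n → ℝ} (hκ : κ ∈ positiveCone n) :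
    f κ ∈ Icc 0 ‖κ‖ :=
  ⟨(hf.positive κ hκ).le, hf.le_norm hκ⟩

end IsSpeedFunction

end SpeedFunction

/-- The part of space-time over the time interval `[a, b]` occupied by the moving region
`{φ(·, t) ≤ 0}`; all barriers below are given in this form. -/
def movingSublevel {E : Type*} (φ : E → ℝ → ℝ) (a b : ℝ) : Set (E × ℝ) :=
  {p | p.2 ∈ Icc a b ∧ φ p.1 p.2 ≤ 0}

lemma slice_movingSublevel {E : Type*} (φ : E → ℝ → ℝ) {a b t : ℝ} (ht : t ∈ Icc a b) :
    slice (movingSublevel φ a b) t = {x | φ x t ≤ 0} :=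
  ext fun _ => and_iff_right ht

section Barriers

variable {n : ℕ} {f : (Fin n → ℝ) → ℝ} {α a b : ℝ}
  {φ : EuclideanSpace ℝ (Fin (n + 1)) → ℝ → ℝ}

lemma IsInnerBarrier.nonpos_of_mem_slice {I : Set ℝ}
    {A : Set (EuclideanSpace ℝ (Fin (n + 1)) × ℝ)} (hA : IsInnerBarrier f α I A) (hab : a ≤ b)
    (hI : Icc a b ⊆ I) (hφ : IsSmoothSupersolution f α a b (movingSublevel φ a b))
    (hstart : ∀ x ∈ slice A a, φ x a ≤ 0) {x : EuclideanSpace ℝ (Fin (n + 1))}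
    (hx : x ∈ slice A b) : φ x b ≤ 0 := by
  rcases hab.eq_or_lt with rfl | hlt
  · exact hstart x hx
  have hsub := hA.2 a b hlt hI _ hφ
  rw [slice_movingSublevel φ (left_mem_Icc.2 hab)] at hsub
  exact (hsub hstart b (right_mem_Icc.2 hab) hx).2

lemma IsOuterBarrier.mem_slice_of_nonpos {I : Set ℝ}
    {A : Set (EuclideanSpace ℝ (Fin (n + 1)) × ℝ)} (hA : IsOuterBarrier f α I A) (hab : a ≤ b)
    (hI : Icc a b ⊆ I) (hφ : IsSmoothSubsolution f α a b (movingSublevel φ a b))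
    (hstart : ∀ x, φ x a ≤ 0 → x ∈ slice A a) {x : EuclideanSpace ℝ (Fin (n + 1))}
    (hx : φ x b ≤ 0) : x ∈ slice A b := by
  rcases hab.eq_or_lt with rfl | hlt
  · exact hstart x hx
  have hsub := hA.2 a b hlt hI _ hφ
  rw [slice_movingSublevel φ (left_mem_Icc.2 hab)] at hsub
  exact hsub hstart b (right_mem_Icc.2 hab) ⟨right_mem_Icc.2 hab, hx⟩

lemma isSmoothEvolution_movingSublevel {R : ℝ → (Fin n → ℝ) → Prop}
    (hφ : ContDiff ℝ ∞ fun q : EuclideanSpace ℝ (Fin (n + 1)) × ℝ => φ q.1 q.2)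
    (hgrad : ∀ t ∈ Icc a b, ∀ x, φ x t = 0 → fderiv ℝ (fun y => φ y t) x ≠ 0)
    (hR : ∀ t ∈ Icc a b, ∀ x, φ x t = 0 → ∀ κ, IsPrincipalCurvatures (fun y => φ y t) x κ →
      κ ∈ positiveCone n ∧ R (inwardVelocity φ x t) κ) :
    IsSmoothEvolution R a b (movingSublevel φ a b) where
  subset := fun _ hp => ⟨mem_univ _, hp.1⟩
  closed := (isClosed_Icc.preimage continuous_snd).inter
    (isClosed_le hφ.continuous continuous_const)
  interior_mem := by
    intro t ht x hx
    rw [slice_movingSublevel φ ht] at hx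
    have hne : φ x t ≠ 0 := by
      intro h0
      have hmax : IsLocalMax (fun y => φ y t) x := by
        filter_upwards [mem_interior_iff_mem_nhds.1 hx] with y hy
        exact hy.trans_eq h0.symm
      exact hgrad t ht x h0 hmax.fderiv_eq_zero
    have hlt : φ x t < 0 := lt_of_le_of_ne (interior_subset (s := {x | φ x t ≤ 0}) hx) hne
    have hnhds : ∀ᶠ p in 𝓝 (x, t), φ p.1 p.2 < 0 :=
      hφ.continuous.continuousAt.eventually_lt continuousAt_const hlt
    filter_upwards [nhdsWithin_le_nhds hnhds, self_mem_nhdsWithin] with p hp hpI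
    exact ⟨hpI.2, hp.le⟩
  boundary := by
    intro t ht x hx
    rw [slice_movingSublevel φ ht] at hx
    have hcont : Continuous fun y => φ y t :=
      hφ.continuous.comp (continuous_id.prodMk continuous_const)
    have h0 : φ x t = 0 := frontier_le_subset_eq hcont continuous_const hx
    refine ⟨φ, ⟨Eventually.of_forall fun p => hφ.contDiffAt, hgrad t ht x h0, ?_⟩, hR t ht x h0⟩
    filter_upwards [self_mem_nhdsWithin] with p hp
    exact and_iff_right hp.2

section PrincipalCurvatures

variable {ψ : EuclideanSpace ℝ (Fin (n + 1)) → ℝ} {x : EuclideanSpace ℝ (Fin (n + 1))}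
  {κ : Fin n → ℝ}

lemma IsPrincipalCurvatures.exists_norm_eq_one (h : IsPrincipalCurvatures ψ x κ) (i : Fin n) :
    ∃ e : EuclideanSpace ℝ (Fin (n + 1)), ‖e‖ = 1 ∧
      κ i = fderiv ℝ (fderiv ℝ ψ) x e e / ‖fderiv ℝ ψ x‖ := by
  obtain ⟨e, he, -, hκ⟩ := h
  exact ⟨e i, he.1 i, by simpa using (hκ i i).symm⟩

lemma IsPrincipalCurvatures.mem_positiveCone (h : IsPrincipalCurvatures ψ x κ)
    (hgrad : fderiv ℝ ψ x ≠ 0) (hpos : ∀ e, ‖e‖ = 1 → 0 < fderiv ℝ (fderiv ℝ ψ) x e e) :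
    κ ∈ positiveCone n := by
  intro i
  obtain ⟨e, he, hi⟩ := h.exists_norm_eq_one i
  rw [hi]
  exact div_pos (hpos e he) (norm_pos_iff.2 hgrad)

lemma IsPrincipalCurvatures.norm_le (h : IsPrincipalCurvatures ψ x κ) {K : ℝ}
    (hK : ∀ e, ‖e‖ = 1 → |fderiv ℝ (fderiv ℝ ψ) x e e| ≤ K) : ‖κ‖ ≤ K / ‖fderiv ℝ ψ x‖ := by
  obtain ⟨e₀, he₀⟩ := exists_norm_eq (EuclideanSpace ℝ (Fin (n + 1))) zero_le_one
  have hK0 : 0 ≤ K := (abs_nonneg _).trans (hK e₀ he₀)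
  refine (pi_norm_le_iff_of_nonneg (by positivity)).2 fun i => ?_
  obtain ⟨e, he, hi⟩ := h.exists_norm_eq_one i
  rw [hi, norm_div, norm_norm, Real.norm_eq_abs]
  gcongr
  exact hK e he

end PrincipalCurvatures

lemma isSmoothSubsolution_movingSublevel (hα : 0 ≤ α)
    (hf : ∀ κ ∈ positiveCone n, f κ ∈ Icc 0 ‖κ‖)
    (hφ : ContDiff ℝ ∞ fun q : EuclideanSpace ℝ (Fin (n + 1)) × ℝ => φ q.1 q.2)
    (hgrad : ∀ t ∈ Icc a b, ∀ x, φ x t = 0 → fderiv ℝ (fun y => φ y t) x ≠ 0)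
    (hspeed : ∀ t ∈ Icc a b, ∀ x, φ x t = 0 → ∃ K,
      (∀ e, ‖e‖ = 1 → fderiv ℝ (fderiv ℝ fun y => φ y t) x e e ∈ Ioc 0 K) ∧
        (K / ‖fderiv ℝ (fun y => φ y t) x‖) ^ α ≤ inwardVelocity φ x t) :
    IsSmoothSubsolution f α a b (movingSublevel φ a b) := by
  refine isSmoothEvolution_movingSublevel hφ hgrad fun t ht x hx κ hκ => ?_
  obtain ⟨K, hK, hspeedK⟩ := hspeed t ht x hx
  have hcone : κ ∈ positiveCone n :=
    hκ.mem_positiveCone (hgrad t ht x hx) fun e he => (hK e he).1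
  have hnorm : ‖κ‖ ≤ K / ‖fderiv ℝ (fun y => φ y t) x‖ :=
    hκ.norm_le fun e he => abs_le.2 ⟨by linarith [(hK e he).1, (hK e he).2], (hK e he).2⟩
  exact ⟨hcone,
    (Real.rpow_le_rpow (hf κ hcone).1 ((hf κ hcone).2.trans hnorm) hα).trans hspeedK⟩

lemma isSmoothSupersolution_stationary (hf : ∀ κ ∈ positiveCone n, 0 ≤ f κ)
    {ψ : EuclideanSpace ℝ (Fin (n + 1)) → ℝ} (hψ : ContDiff ℝ ∞ ψ)
    (hgrad : ∀ x, ψ x = 0 → fderiv ℝ ψ x ≠ 0)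
    (hconv : ∀ x, ψ x = 0 → ∀ e, ‖e‖ = 1 → 0 < fderiv ℝ (fderiv ℝ ψ) x e e) :
    IsSmoothSupersolution f α a b (movingSublevel (fun x _ => ψ x) a b) := by
  refine isSmoothEvolution_movingSublevel (hψ.comp contDiff_fst) (fun _ _ => hgrad)
    fun t _ x hx κ hκ => ?_
  have hcone : κ ∈ positiveCone n := hκ.mem_positiveCone (hgrad x hx) (hconv x hx)
  refine ⟨hcone, ?_⟩
  simp only [inwardVelocity, deriv_const, zero_div]
  exact Real.rpow_nonneg (hf κ hcone) α

end Barriers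

section LinearAddRadial

variable {E : Type*} [NormedAddCommGroup E] [InnerProductSpace ℝ E] {c z x : E}
  {g g' : ℝ → ℝ} {g'' : ℝ}

lemma hasFDerivAt_norm_sub_sq (c x : E) :
    HasFDerivAt (fun y => ‖y - c‖ ^ 2) (2 • innerSL ℝ (x - c)) x := by
  simpa using ((hasFDerivAt_id x).sub_const c).norm_sq

lemma hasFDerivAt_inner_add_radial (c z : E) {d : ℝ} (hg : HasDerivAt g d (‖x - c‖ ^ 2)) :
    HasFDerivAt (fun y => inner ℝ (y - c) z + g (‖y - c‖ ^ 2))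
      (innerSL ℝ (z + (2 * d) • (x - c))) x := by
  have hlin : HasFDerivAt (fun y => inner ℝ (y - c) z) (innerSL ℝ z) x := by
    have h := (innerSL ℝ z).hasFDerivAt.comp x ((hasFDerivAt_id x).sub_const c)
    refine (h.congr_of_eventuallyEq (Eventually.of_forall fun y => ?_)).congr_fderiv ?_
    · exact real_inner_comm z (y - c)
    · exact (innerSL ℝ z).comp_id
  refine (hlin.add (hg.comp_hasFDerivAt x (hasFDerivAt_norm_sub_sq c x))).congr_fderiv ?_
  ext e
  simp only [map_sub, map_add, map_smul, add_apply, sub_apply, smul_apply, coe_innerSL_apply,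
    nsmul_eq_mul, Nat.cast_ofNat, smul_eq_mul, add_right_inj]
  ring

lemma fderiv_fderiv_inner_add_radial (z : E) (hg : ∀ s, HasDerivAt g (g' s) s)
    (hg' : HasDerivAt g' g'' (‖x - c‖ ^ 2)) (e : E) :
    fderiv ℝ (fderiv ℝ fun y => inner ℝ (y - c) z + g (‖y - c‖ ^ 2)) x e e
      = 2 * g' (‖x - c‖ ^ 2) * ‖e‖ ^ 2 + 4 * g'' * inner ℝ (x - c) e ^ 2 := by
  have hfirst : (fderiv ℝ fun y => inner ℝ (y - c) z + g (‖y - c‖ ^ 2))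
      = fun y => innerSL ℝ (z + (2 * g' (‖y - c‖ ^ 2)) • (y - c)) :=
    funext fun y => (hasFDerivAt_inner_add_radial c z (hg _)).fderiv
  have hgradient := ((((hg'.comp_hasFDerivAt x (hasFDerivAt_norm_sub_sq c x)).const_mul 2).smul
    ((hasFDerivAt_id x).sub_const c)).const_add z)
  have hsecond : HasFDerivAt (fun y => innerSL ℝ (z + (2 * g' (‖y - c‖ ^ 2)) • (y - c))) _ x :=
    (innerSL ℝ (E := E)).hasFDerivAt.comp x hgradient
  rw [hfirst, hsecond.fderiv]
  change inner ℝ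
    ((2 * g' (‖x - c‖ ^ 2)) • e + (2 * (g'' * (2 • inner ℝ (x - c) e))) • (x - c)) e = _
  rw [inner_add_left, real_inner_smul_left, real_inner_smul_left, real_inner_self_eq_norm_sq]
  ring

lemma fderiv_fderiv_inner_add_radial_mem_Ioc (z : E) (hg : ∀ s, HasDerivAt g (g' s) s)
    (hg' : HasDerivAt g' g'' (‖x - c‖ ^ 2)) (hpos : 0 < g' (‖x - c‖ ^ 2)) (hnonneg : 0 ≤ g'')
    {e : E} (he : ‖e‖ = 1) :
    fderiv ℝ (fderiv ℝ fun y => inner ℝ (y - c) z + g (‖y - c‖ ^ 2)) x e e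
      ∈ Ioc 0 (2 * g' (‖x - c‖ ^ 2) + 4 * g'' * ‖x - c‖ ^ 2) := by
  rw [fderiv_fderiv_inner_add_radial z hg hg', he, one_pow, mul_one]
  have hcs : (inner ℝ (x - c) e : ℝ) ^ 2 ≤ ‖x - c‖ ^ 2 := by
    simpa [he] using sq_le_sq' (neg_le_of_abs_le (abs_real_inner_le_norm (x - c) e))
      (le_of_abs_le (abs_real_inner_le_norm (x - c) e))
  exact ⟨by positivity, by gcongr⟩

end LinearAddRadial

section HalfSpace

variable {E : Type*} [NormedAddCommGroup E] [InnerProductSpace ℝ E] {y₀ z : E} {S : Set E}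

lemma exists_subset_closedBall_notMem (hS : Bornology.IsBounded S)
    (hhalf : ∀ y ∈ S, inner ℝ (y - y₀) z ≤ 0) {x : E} (hx : 0 < inner ℝ (x - y₀) z) :
    ∃ (c : E) (R : ℝ), 0 < R ∧ S ⊆ Metric.closedBall c R ∧ x ∉ Metric.closedBall c R := by
  obtain ⟨D, hD, hSD⟩ := hS.subset_closedBall_lt 0 y₀
  set s : ℝ := inner ℝ (x - y₀) z with hs
  set L : ℝ := D ^ 2 / s
  have hLs : L * s = D ^ 2 := div_mul_cancel₀ _ hx.ne'
  have hL0 : 0 < L := by positivity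
  have hexpand : ∀ y, ‖y - (y₀ - L • z)‖ ^ 2
      = ‖y - y₀‖ ^ 2 + 2 * (L * inner ℝ (y - y₀) z) + ‖L • z‖ ^ 2 := by
    intro y
    rw [show y - (y₀ - L • z) = (y - y₀) + L • z by abel, norm_add_sq_real, inner_smul_right]
  have hmem : ∀ y, y ∈ Metric.closedBall (y₀ - L • z) √(D ^ 2 + ‖L • z‖ ^ 2) ↔
      ‖y - y₀‖ ^ 2 + 2 * (L * inner ℝ (y - y₀) z) ≤ D ^ 2 := by
    intro y
    rw [mem_closedBall_iff_norm, Real.le_sqrt (norm_nonneg _) (by positivity), hexpand,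
      add_le_add_iff_right]
  refine ⟨y₀ - L • z, √(D ^ 2 + ‖L • z‖ ^ 2), by positivity, fun y hy => ?_, fun h => ?_⟩
  · have hnorm : ‖y - y₀‖ ^ 2 ≤ D ^ 2 :=
      pow_le_pow_left₀ (norm_nonneg _) (mem_closedBall_iff_norm.1 (hSD hy)) 2
    have hinner := mul_nonpos_of_nonneg_of_nonpos hL0.le (hhalf y hy)
    exact (hmem y).2 (by linarith)
  · have h' := (hmem x).1 h
    rw [← hs, hLs] at h'
    linarith [sq_nonneg ‖x - y₀‖, pow_pos hD 2]

lemma notMem_interior_of_inner_nonpos (hz : z ≠ 0) (hS : ∀ x ∈ S, inner ℝ (x - y₀) z ≤ 0) :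
    y₀ ∉ interior S := by
  intro hy₀
  have hmax : IsLocalMax (fun x => innerSL ℝ z (x - y₀)) y₀ := by
    filter_upwards [mem_interior_iff_mem_nhds.1 hy₀] with x hx
    simpa [real_inner_comm] using hS x hx
  have hderiv := hmax.hasFDerivAt_eq_zero
    ((innerSL ℝ z).hasFDerivAt.comp y₀ ((hasFDerivAt_id y₀).sub_const y₀))
  have hzz := DFunLike.congr_fun hderiv z
  exact hz (by simpa using hzz)

end HalfSpace

section InnerBarrier

variable {n : ℕ} {f : (Fin n → ℝ) → ℝ} {α a b : ℝ}

lemma isSmoothSupersolution_closedBall (hf : ∀ κ ∈ positiveCone n, 0 ≤ f κ)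
    (c : EuclideanSpace ℝ (Fin (n + 1))) {R : ℝ} (hR : R ≠ 0) :
    IsSmoothSupersolution f α a b (movingSublevel (fun x _ => ‖x - c‖ ^ 2 - R ^ 2) a b) := by
  have hradial : (fun y : EuclideanSpace ℝ (Fin (n + 1)) => ‖y - c‖ ^ 2 - R ^ 2)
      = fun y => inner ℝ (y - c) 0 + (fun s : ℝ => s - R ^ 2) (‖y - c‖ ^ 2) := by
    simp only [inner_zero_right, zero_add]
  have hg : ∀ s : ℝ, HasDerivAt (fun s : ℝ => s - R ^ 2) ((fun _ => (1 : ℝ)) s) s := fun s =>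
    (hasDerivAt_id s).sub_const _
  refine isSmoothSupersolution_stationary hf
    (((contDiff_id.sub contDiff_const).norm_sq ℝ).sub contDiff_const) (fun x hx h0 => ?_)
    fun x _ e he => ?_
  · rw [((hasFDerivAt_norm_sub_sq c x).sub_const _).fderiv] at h0
    have hcenter : 2 * ‖x - c‖ ^ 2 = 0 := by
      rw [← real_inner_self_eq_norm_sq, ← Nat.cast_ofNat, ← nsmul_eq_mul]
      exact DFunLike.congr_fun h0 (x - c)
    exact pow_ne_zero 2 hR (by linarith)
  · rw [hradial]
    exact (fderiv_fderiv_inner_add_radial_mem_Ioc 0 hg (hasDerivAt_const _ _) one_pos le_rfl he).1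

lemma IsInnerBarrier.slice_subset_closedBall (hf : ∀ κ ∈ positiveCone n, 0 ≤ f κ) {I : Set ℝ}
    {A : Set (EuclideanSpace ℝ (Fin (n + 1)) × ℝ)} (hA : IsInnerBarrier f α I A) (hab : a ≤ b)
    (hI : Icc a b ⊆ I) {c : EuclideanSpace ℝ (Fin (n + 1))} {R : ℝ} (hR : 0 < R)
    (hstart : slice A a ⊆ Metric.closedBall c R) : slice A b ⊆ Metric.closedBall c R := by
  have hball : ∀ x, x ∈ Metric.closedBall c R ↔ ‖x - c‖ ^ 2 - R ^ 2 ≤ 0 := fun x => by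
    rw [mem_closedBall_iff_norm, sub_nonpos, pow_le_pow_iff_left₀ (norm_nonneg _) hR.le two_ne_zero]
  exact fun x hx => (hball x).2 <| hA.nonpos_of_mem_slice (φ := fun x _ => ‖x - c‖ ^ 2 - R ^ 2)
    hab hI (isSmoothSupersolution_closedBall hf c hR.ne') (fun y hy => (hball y).1 (hstart hy)) hx

lemma IsInnerBarrier.inner_nonpos_of_mem_slice (hf : ∀ κ ∈ positiveCone n, 0 ≤ f κ) {I : Set ℝ}
    {A : Set (EuclideanSpace ℝ (Fin (n + 1)) × ℝ)} (hA : IsInnerBarrier f α I A) (hab : a ≤ b)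
    (hI : Icc a b ⊆ I) (hbdd : Bornology.IsBounded (slice A a))
    {y₀ z : EuclideanSpace ℝ (Fin (n + 1))} (hhalf : ∀ y ∈ slice A a, inner ℝ (y - y₀) z ≤ 0)
    {x : EuclideanSpace ℝ (Fin (n + 1))} (hx : x ∈ slice A b) : inner ℝ (x - y₀) z ≤ 0 := by
  by_contra! hpos
  obtain ⟨c, R, hR, hsub, hxR⟩ := exists_subset_closedBall_notMem hbdd hhalf hpos
  exact hxR (hA.slice_subset_closedBall hf hab hI hR hsub hx)

end InnerBarrier

/-- The strictly convex function whose sublevel sets `{flatCap ≤ 0}` are the caps used as inner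
barriers at a flat side with outer normal `z` at `y₀`. The cap has width `r`, the amplitude `τ`
controls its height, its flatness at the tip is of order `2 m`, and `η` lifts it off the supporting
hyperplane. -/
noncomputable def flatCap {E : Type*} [NormedAddCommGroup E] [InnerProductSpace ℝ E]
    (y₀ z : E) (m : ℕ) (r η τ : ℝ) (x : E) : ℝ :=
  inner ℝ (x - y₀) z + (τ * r * (‖x - y₀‖ ^ 2 / r ^ 2) ^ m + η)

section FlatCap

variable {E : Type*} [NormedAddCommGroup E] [InnerProductSpace ℝ E] {y₀ z x : E} {m : ℕ}
  {r η τ : ℝ}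

lemma norm_sub_lt_of_flatCap_nonpos (hm : m ≠ 0) (hr : 0 < r) (hη : 0 < η) (hτ : 1 ≤ τ)
    (hz : ‖z‖ = 1) (hx : flatCap y₀ z m r η τ x ≤ 0) : ‖x - y₀‖ < r := by
  by_contra! hle
  have hratio : 1 ≤ ‖x - y₀‖ / r := (one_le_div hr).2 hle
  have hinner : -‖x - y₀‖ ≤ inner ℝ (x - y₀) z := by
    simpa [hz] using neg_le_of_abs_le (abs_real_inner_le_norm (x - y₀) z)
  have hradial : ‖x - y₀‖ ≤ τ * r * (‖x - y₀‖ ^ 2 / r ^ 2) ^ m :=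
    calc ‖x - y₀‖ = 1 * r * (‖x - y₀‖ / r) := by field_simp
      _ ≤ τ * r * (‖x - y₀‖ / r) ^ (2 * m) := by
        gcongr
        exact le_self_pow₀ hratio (by omega)
      _ = τ * r * (‖x - y₀‖ ^ 2 / r ^ 2) ^ m := by rw [pow_mul, div_pow]
  unfold flatCap at hx
  linarith

lemma inner_neg_of_flatCap_nonpos (hr : 0 ≤ r) (hη : 0 < η) (hτ : 0 ≤ τ)
    (hx : flatCap y₀ z m r η τ x ≤ 0) : inner ℝ (x - y₀) z < 0 := by
  have hradial : 0 ≤ τ * r * (‖x - y₀‖ ^ 2 / r ^ 2) ^ m := by positivity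
  unfold flatCap at hx
  linarith

lemma flatCap_sub_smul_nonpos (hm : m ≠ 0) (hr : 0 < r) (hη : 0 ≤ η) (hηr : 8 * η ≤ r)
    (hτ : τ ≤ 2) (hz : ‖z‖ = 1) : flatCap y₀ z m r η τ (y₀ - (2 * η) • z) ≤ 0 := by
  have hinner : inner ℝ (y₀ - (2 * η) • z - y₀) z = -(2 * η) := by
    rw [sub_sub_cancel_left, inner_neg_left, inner_smul_left, real_inner_self_eq_norm_sq, hz]
    simp
  have hnorm : ‖y₀ - (2 * η) • z - y₀‖ ^ 2 / r ^ 2 = (2 * η / r) ^ 2 := by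
    rw [sub_sub_cancel_left, norm_neg, norm_smul, hz, mul_one, Real.norm_eq_abs, sq_abs, div_pow]
  have hratio : (2 * η / r) ^ 2 ≤ 1 := by
    refine pow_le_one₀ (by positivity) ((div_le_one hr).2 (by linarith))
  have hradial : τ * r * ((2 * η / r) ^ 2) ^ m ≤ η :=
    calc τ * r * ((2 * η / r) ^ 2) ^ m ≤ 2 * r * (2 * η / r) ^ 2 := by
          gcongr
          exact pow_le_of_le_one (by positivity) hratio hm
      _ = (8 * η) * η / r := by field_simp; ring
      _ ≤ r * η / r := by gcongr
      _ = η := mul_div_cancel_left₀ η hr.ne'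
  rw [flatCap, hinner, hnorm]
  linarith

lemma hasDerivAt_mul_div_pow (A ρ B : ℝ) (m : ℕ) (s : ℝ) :
    HasDerivAt (fun s => A * (s / ρ) ^ m + B) (A * (m / ρ) * (s / ρ) ^ (m - 1)) s := by
  refine (((((hasDerivAt_id s).div_const ρ).pow m).const_mul A).add_const B).congr_deriv ?_
  simp only [id]
  ring

lemma hasFDerivAt_flatCap (y₀ z : E) (m : ℕ) (r η τ : ℝ) (x : E) :
    HasFDerivAt (flatCap y₀ z m r η τ)
      (innerSL ℝ (z + (2 * (τ * r * (m / r ^ 2) * (‖x - y₀‖ ^ 2 / r ^ 2) ^ (m - 1))) • (x - y₀)))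
      x :=
  hasFDerivAt_inner_add_radial y₀ z (hasDerivAt_mul_div_pow (τ * r) (r ^ 2) η m _)

lemma norm_sub_sq_div_pos_of_flatCap_eq_zero (hm : m ≠ 0) (hr : 0 < r) (hη : 0 < η)
    (hx : flatCap y₀ z m r η τ x = 0) : 0 < ‖x - y₀‖ ^ 2 / r ^ 2 := by
  have hne : x - y₀ ≠ 0 := by
    intro h0
    simp only [flatCap, h0, inner_zero_left, norm_zero, ne_eq, OfNat.ofNat_ne_zero,
      not_false_eq_true, zero_pow, zero_div, hm, mul_zero, zero_add] at hx
    exact hη.ne' hx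
  positivity

lemma fderiv_fderiv_flatCap_mem_Ioc (hm : 1 < m) (hr : 0 < r) (hη : 0 < η) (hτ : 0 < τ)
    (hτ2 : τ ≤ 2) (hx : flatCap y₀ z m r η τ x = 0) {e : E} (he : ‖e‖ = 1) :
    fderiv ℝ (fderiv ℝ (flatCap y₀ z m r η τ)) x e e
      ∈ Ioc 0 (4 * m * (2 * m - 1) / r * (‖x - y₀‖ ^ 2 / r ^ 2) ^ (m - 1)) := by
  have hu := norm_sub_sq_div_pos_of_flatCap_eq_zero (by omega) hr hη hx
  have hm1 : (0 : ℝ) < m - 1 := sub_pos.2 (by exact_mod_cast hm)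
  have hsecond (s : ℝ) := hasDerivAt_mul_div_pow (τ * r * (m / r ^ 2)) (r ^ 2) 0 (m - 1) s
  simp only [add_zero, Nat.cast_pred (zero_lt_one.trans hm)] at hsecond
  have hIoc := fderiv_fderiv_inner_add_radial_mem_Ioc z
    (hasDerivAt_mul_div_pow (τ * r) (r ^ 2) η m) (hsecond (‖x - y₀‖ ^ 2)) (by positivity)
    (by positivity) he
  refine Ioc_subset_Ioc_right ?_ hIoc
  calc _ = 2 * m * (2 * m - 1) / r * τ * (‖x - y₀‖ ^ 2 / r ^ 2) ^ (m - 1) := by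
        rw [← pow_sub_one_mul (by omega : m - 1 ≠ 0) (‖x - y₀‖ ^ 2 / r ^ 2)]
        field_simp
        ring
    _ ≤ 2 * m * (2 * m - 1) / r * 2 * (‖x - y₀‖ ^ 2 / r ^ 2) ^ (m - 1) := by
        have hm2 : (0 : ℝ) < 2 * m - 1 := by linarith
        gcongr
    _ = _ := by ring

lemma half_le_norm_fderiv_flatCap (hm : m ≠ 0) (hr : 0 < r) (hη : 0 ≤ η) (hηr : 16 * m * η ≤ r)
    (hτ : 0 ≤ τ) (hτ2 : τ ≤ 2) (hz : ‖z‖ = 1) (hxr : ‖x - y₀‖ ≤ r)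
    (hx : flatCap y₀ z m r η τ x = 0) :
    1 / 2 ≤ ‖fderiv ℝ (flatCap y₀ z m r η τ) x‖ := by
  set u := ‖x - y₀‖ ^ 2 / r ^ 2 with hu
  have hu1 : u ≤ 1 := (div_le_one (by positivity)).2 (by gcongr)
  set d := τ * r * (m / r ^ 2) * u ^ (m - 1) with hd
  set P := τ * r * u ^ m with hP
  have hd0 : 0 ≤ d := by positivity
  have hP0 : 0 ≤ P := by positivity
  have hm1 : (1 : ℝ) ≤ m := by exact_mod_cast Nat.one_le_iff_ne_zero.2 hm
  have heuler : d * ‖x - y₀‖ ^ 2 = m * P := by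
    rw [hd, hP, ← pow_sub_one_mul hm u, hu]
    field_simp
  have hlift : 8 * d * η ≤ 1 := by
    have hdr : d ≤ 2 * m / r :=
      calc d = τ * m / r * u ^ (m - 1) := by rw [hd]; field_simp
        _ ≤ 2 * m / r * 1 := by
          gcongr
          exact pow_le_one₀ (by positivity) hu1
        _ = 2 * m / r := mul_one _
    calc 8 * d * η ≤ 8 * (2 * m / r) * η := by gcongr
      _ = 16 * m * η / r := by ring
      _ ≤ 1 := (div_le_one hr).2 hηr
  have hinner : inner ℝ z (x - y₀) = -(P + η) := by
    rw [real_inner_comm]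
    exact eq_neg_of_add_eq_zero_left hx
  have hnorm : ‖z + (2 * d) • (x - y₀)‖ ^ 2 = 1 + 4 * (m - 1) * (d * P) - 4 * d * η := by
    rw [norm_add_sq_real, hz, inner_smul_right, hinner, norm_smul, mul_pow, Real.norm_eq_abs,
      sq_abs]
    linear_combination 4 * d * heuler
  rw [(hasFDerivAt_flatCap y₀ z m r η τ x).fderiv, innerSL_apply_norm]
  refine le_of_sq_le_sq ?_ (norm_nonneg _)
  have hconv : 0 ≤ (m - 1) * (d * P) := mul_nonneg (by linarith) (mul_nonneg hd0 hP0)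
  linarith

end FlatCap

section OuterBarrier

lemma div_rpow_le_div_of_half_le {α K V G : ℝ} (hα : 1 ≤ α) (hK : 0 ≤ K) (hG : 1 / 2 ≤ G)
    (h : (2 * K) ^ α ≤ V) : (K / G) ^ α ≤ V / G := by
  have hG0 : 0 < G := by linarith
  have hV : 0 ≤ V := (Real.rpow_nonneg (by positivity) α).trans h
  calc (K / G) ^ α = (2 * K) ^ α / (2 * G) ^ α := by
        rw [← Real.div_rpow (by positivity) (by positivity), mul_div_mul_left _ _ two_ne_zero]
    _ ≤ V / (2 * G) := by
        gcongr
        exact Real.self_le_rpow_of_one_le (by linarith) hα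
    _ ≤ V / G := by
        gcongr
        linarith

lemma pow_pred_rpow_le_pow {α u : ℝ} {m : ℕ} (hm : m ≠ 0) (hmα : m ≤ (m - 1) * α) (hu : 0 ≤ u)
    (hu1 : u ≤ 1) : (u ^ (m - 1)) ^ α ≤ u ^ m := by
  rw [← Real.rpow_natCast, ← Real.rpow_mul hu, Nat.cast_pred (Nat.pos_of_ne_zero hm),
    ← Real.rpow_natCast u m]
  exact Real.rpow_le_rpow_of_exponent_ge' hu hu1 (Nat.cast_nonneg m) hmα

lemma mul_pow_pred_rpow_le_mul_pow {α c u v : ℝ} {m : ℕ} (hm : m ≠ 0) (hmα : m ≤ (m - 1) * α)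
    (hc : 0 ≤ c) (hcv : c ^ α ≤ v) (hu : 0 ≤ u) (hu1 : u ≤ 1) :
    (c * u ^ (m - 1)) ^ α ≤ v * u ^ m := by
  have hv : 0 ≤ v := (Real.rpow_nonneg hc α).trans hcv
  rw [Real.mul_rpow hc (by positivity)]
  gcongr
  exact pow_pred_rpow_le_pow hm hmα hu hu1

lemma div_rpow_eq_div_rpow_neg_mul {c r : ℝ} (hc : 0 < c) (hr : 0 < r) (α : ℝ) :
    (c / r) ^ α = r / (c ^ (-α) * r ^ (1 + α)) := by
  rw [Real.div_rpow hc.le hr.le, Real.rpow_neg hc.le, Real.rpow_add hr, Real.rpow_one]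
  have hcα : c ^ α ≠ 0 := (Real.rpow_pos_of_pos hc α).ne'
  field_simp

lemma exists_nat_le_sub_one_mul {α : ℝ} (hα : 1 < α) : ∃ m : ℕ, 1 < m ∧ (m : ℝ) ≤ (m - 1) * α := by
  obtain ⟨m, hm⟩ := exists_nat_gt (α / (α - 1))
  have hα1 : 0 < α - 1 := sub_pos.2 hα
  refine ⟨m, ?_, by linarith [(div_lt_iff₀ hα1).1 hm]⟩
  have h1 : 1 < α / (α - 1) := (one_lt_div hα1).2 (by linarith)
  exact_mod_cast h1.trans hm

/-- The flat cap whose amplitude grows linearly, from `1` at time `0` to `2` at time `d`. -/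
noncomputable def movingFlatCap {E : Type*} [NormedAddCommGroup E] [InnerProductSpace ℝ E]
    (y₀ z : E) (m : ℕ) (r η d : ℝ) (x : E) (t : ℝ) : ℝ :=
  flatCap y₀ z m r η (1 + t / d) x

lemma contDiff_movingFlatCap {E : Type*} [NormedAddCommGroup E] [InnerProductSpace ℝ E]
    (y₀ z : E) (m : ℕ) (r η d : ℝ) :
    ContDiff ℝ ∞ fun q : E × ℝ => movingFlatCap y₀ z m r η d q.1 q.2 := by
  have hsub : ContDiff ℝ ∞ fun q : E × ℝ => q.1 - y₀ := contDiff_fst.sub contDiff_const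
  have hτ : ContDiff ℝ ∞ fun q : E × ℝ => (1 + q.2 / d) * r :=
    (contDiff_const.add (contDiff_snd.div_const d)).mul contDiff_const
  exact (hsub.inner ℝ contDiff_const).add
    ((hτ.mul (((hsub.norm_sq ℝ).div_const _).pow m)).add contDiff_const)

lemma deriv_movingFlatCap {E : Type*} [NormedAddCommGroup E] [InnerProductSpace ℝ E]
    (y₀ z : E) (m : ℕ) (r η d : ℝ) (x : E) (t : ℝ) :
    deriv (movingFlatCap y₀ z m r η d x) t = r / d * (‖x - y₀‖ ^ 2 / r ^ 2) ^ m := by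
  have hτ : HasDerivAt (fun s => 1 + s / d) (1 / d) t :=
    ((hasDerivAt_id t).div_const d).const_add 1
  have hcap : HasDerivAt (movingFlatCap y₀ z m r η d x)
      (1 / d * r * (‖x - y₀‖ ^ 2 / r ^ 2) ^ m) t :=
    (((hτ.mul_const r).mul_const _).add_const η).const_add _
  rw [hcap.deriv, one_div_mul_eq_div]

variable {n : ℕ} {f : (Fin n → ℝ) → ℝ} {α b d r η : ℝ} {m : ℕ}
  {y₀ z : EuclideanSpace ℝ (Fin (n + 1))}

lemma isSmoothSubsolution_movingFlatCap (hf : ∀ κ ∈ positiveCone n, f κ ∈ Icc 0 ‖κ‖)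
    (hm : 1 < m) (hmα : m ≤ (m - 1) * α) (hr : 0 < r) (hd : 0 < d)
    (hdr : (8 * m * (2 * m - 1) / r) ^ α ≤ r / d) (hbd : b ≤ d) (hη : 0 < η)
    (hηr : 16 * m * η ≤ r) (hz : ‖z‖ = 1) :
    IsSmoothSubsolution f α 0 b (movingSublevel (movingFlatCap y₀ z m r η d) 0 b) := by
  have hm0 : m ≠ 0 := by omega
  have hm1 : (1 : ℝ) < m := by exact_mod_cast hm
  have hα : 1 ≤ α := le_of_mul_le_mul_left (by linarith) (sub_pos.2 hm1)
  have hamplitude : ∀ t ∈ Icc 0 b, 1 ≤ 1 + t / d ∧ 1 + t / d ≤ 2 := fun t ht => by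
    have h0 : 0 ≤ t / d := div_nonneg ht.1 hd.le
    have h1 : t / d ≤ 1 := (div_le_one hd).2 (ht.2.trans hbd)
    constructor <;> linarith
  have hwidth : ∀ t ∈ Icc 0 b, ∀ x, movingFlatCap y₀ z m r η d x t = 0 → ‖x - y₀‖ < r :=
    fun t ht x hx => norm_sub_lt_of_flatCap_nonpos hm0 hr hη (hamplitude t ht).1 hz hx.le
  have hgrad : ∀ t ∈ Icc 0 b, ∀ x, movingFlatCap y₀ z m r η d x t = 0 →
      1 / 2 ≤ ‖fderiv ℝ (fun y => movingFlatCap y₀ z m r η d y t) x‖ := fun t ht x hx =>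
    half_le_norm_fderiv_flatCap hm0 hr hη.le hηr (zero_le_one.trans (hamplitude t ht).1)
      (hamplitude t ht).2 hz (hwidth t ht x hx).le hx
  refine isSmoothSubsolution_movingSublevel (zero_le_one.trans hα) hf
    (contDiff_movingFlatCap y₀ z m r η d) (fun t ht x hx h0 => ?_) fun t ht x hx => ?_
  · have hhalf := hgrad t ht x hx
    rw [h0, norm_zero] at hhalf
    norm_num at hhalf
  refine ⟨4 * m * (2 * m - 1) / r * (‖x - y₀‖ ^ 2 / r ^ 2) ^ (m - 1), fun e he =>
    fderiv_fderiv_flatCap_mem_Ioc hm hr hη (zero_lt_one.trans_le (hamplitude t ht).1)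
      (hamplitude t ht).2 hx he, ?_⟩
  rw [inwardVelocity, deriv_movingFlatCap]
  have hm2 : (0 : ℝ) < 2 * m - 1 := by linarith
  have hradius : ‖x - y₀‖ ^ 2 / r ^ 2 ≤ 1 := by
    rw [← div_pow]
    exact pow_le_one₀ (by positivity) ((div_le_one hr).2 (hwidth t ht x hx).le)
  refine div_rpow_le_div_of_half_le hα (by positivity) (hgrad t ht x hx) ?_
  convert mul_pow_pred_rpow_le_mul_pow hm0 hmα (by positivity) hdr (by positivity) hradius using 2
  ring

lemma IsOuterBarrier.sub_smul_mem_slice {I : Set ℝ}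
    {A : Set (EuclideanSpace ℝ (Fin (n + 1)) × ℝ)} (hA : IsOuterBarrier f α I A)
    (hf : ∀ κ ∈ positiveCone n, f κ ∈ Icc 0 ‖κ‖) (hm : 1 < m) (hmα : m ≤ (m - 1) * α)
    (hr : 0 < r) (hb : 0 ≤ b) (hI : Icc 0 b ⊆ I)
    (hbr : b ≤ (8 * m * (2 * m - 1)) ^ (-α) * r ^ (1 + α)) (hz : ‖z‖ = 1)
    (hball : ∀ y, ‖y - y₀‖ < r → inner ℝ (y - y₀) z < 0 → y ∈ slice A 0)
    (hη : 0 < η) (hηr : 16 * m * η ≤ r) : y₀ - (2 * η) • z ∈ slice A b := by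
  have hm0 : m ≠ 0 := by omega
  have hm1 : (1 : ℝ) < m := by exact_mod_cast hm
  have hc : (0 : ℝ) < 8 * m * (2 * m - 1) := mul_pos (by positivity) (by linarith)
  set d := (8 * m * (2 * m - 1)) ^ (-α) * r ^ (1 + α)
  have hd : 0 < d := by positivity
  have hb2 : 1 + b / d ≤ 2 := by linarith [(div_le_one hd).2 hbr]
  refine hA.mem_slice_of_nonpos (φ := movingFlatCap y₀ z m r η d) hb hI
    (isSmoothSubsolution_movingFlatCap hf hm hmα hr hd
      (div_rpow_eq_div_rpow_neg_mul hc hr α).le hbr hη hηr hz) (fun y hy => ?_)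
    (flatCap_sub_smul_nonpos hm0 hr hη.le (by nlinarith) hb2 hz)
  have hy1 : flatCap y₀ z m r η 1 y ≤ 0 := by
    simpa only [movingFlatCap, zero_div, add_zero] using hy
  exact hball y (norm_sub_lt_of_flatCap_nonpos hm0 hr hη le_rfl hz hy1)
    (inner_neg_of_flatCap_nonpos hr.le hη zero_le_one hy1)

lemma IsOuterBarrier.mem_closure_slice {I : Set ℝ}
    {A : Set (EuclideanSpace ℝ (Fin (n + 1)) × ℝ)} (hA : IsOuterBarrier f α I A)
    (hf : ∀ κ ∈ positiveCone n, f κ ∈ Icc 0 ‖κ‖) (hm : 1 < m) (hmα : m ≤ (m - 1) * α)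
    (hr : 0 < r) (hb : 0 ≤ b) (hI : Icc 0 b ⊆ I)
    (hbr : b ≤ (8 * m * (2 * m - 1)) ^ (-α) * r ^ (1 + α)) (hz : ‖z‖ = 1)
    (hball : ∀ y, ‖y - y₀‖ < r → inner ℝ (y - y₀) z < 0 → y ∈ slice A 0) :
    y₀ ∈ closure (slice A b) := by
  have hlim : Tendsto (fun η : ℝ => y₀ - (2 * η) • z) (𝓝[>] 0) (𝓝 y₀) := by
    have hcont : Continuous fun η : ℝ => y₀ - (2 * η) • z := by fun_prop
    simpa using (hcont.tendsto 0).mono_left nhdsWithin_le_nhds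
  have hm0 : (0 : ℝ) < 16 * m := by positivity
  refine mem_closure_of_tendsto hlim ?_
  filter_upwards [Ioc_mem_nhdsGT (div_pos hr hm0)] with η hη
  exact hA.sub_smul_mem_slice hf hm hmα hr hb hI hbr hz hball hη.1 ((le_div_iff₀' hm0).1 hη.2)

end OuterBarrier

lemma inner_le_supportFunction {n : ℕ} {S : Set (EuclideanSpace ℝ (Fin (n + 1)))}
    (hS : Bornology.IsBounded S) (z : EuclideanSpace ℝ (Fin (n + 1)))
    {y : EuclideanSpace ℝ (Fin (n + 1))} (hy : y ∈ closure S) :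
    inner ℝ y z ≤ supportFunction S z := by
  obtain ⟨D, hD⟩ := hS.exists_norm_le
  have hbdd : BddAbove ((fun y => inner ℝ y z) '' S) := by
    refine ⟨D * ‖z‖, forall_mem_image.2 fun y hy => (real_inner_le_norm y z).trans ?_⟩
    gcongr
    exact hD y hy
  have hsub : closure S ⊆ {y | inner ℝ y z ≤ supportFunction S z} :=
    closure_minimal (fun y hy => le_csSup hbdd (mem_image_of_mem _ hy))
      (isClosed_le (by fun_prop) continuous_const)
  exact hsub hy

end CurvatureFlow

open CurvatureFlow in
theorem theorem10_general (α : ℝ) (hα : 1 < α) :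
    ∃ C : ℝ, 0 < C ∧
      ∀ (n : ℕ) (f : (Fin n → ℝ) → ℝ), (∀ κ ∈ positiveCone n, f κ ∈ Icc 0 ‖κ‖) →
      ∀ Ω₀ : Set (EuclideanSpace ℝ (Fin (n + 1))), Bornology.IsBounded Ω₀ →
      ∀ z y₀ : EuclideanSpace ℝ (Fin (n + 1)), ‖z‖ = 1 →
        inner ℝ y₀ z = supportFunction Ω₀ z →
      ∀ r : ℝ, 0 < r →
        Metric.ball y₀ r ∩ {y | inner ℝ y z < supportFunction Ω₀ z} ⊆ Ω₀ →
      ∀ (T : ℝ) (A : Set (EuclideanSpace ℝ (Fin (n + 1)) × ℝ)),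
        IsBarrierSolution f α (Icc 0 T) A →
        Ω₀ ⊆ slice A 0 → slice A 0 ⊆ closure Ω₀ →
      ∀ t : ℝ, 0 ≤ t → t ≤ T → t ≤ C * r ^ (1 + α) → y₀ ∈ frontier (slice A t) := by
  obtain ⟨m, hm, hmα⟩ := exists_nat_le_sub_one_mul hα
  have hm1 : (1 : ℝ) < m := by exact_mod_cast hm
  have hc : (0 : ℝ) < 8 * m * (2 * m - 1) := mul_pos (by positivity) (by linarith)
  refine ⟨(8 * m * (2 * m - 1)) ^ (-α), by positivity, ?_⟩
  intro n f hf Ω₀ hbdd z y₀ hz hsupp r hr hball T A hA hΩA hAΩ t ht0 htT htr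
  have hI : Icc 0 t ⊆ Icc 0 T := Icc_subset_Icc_right htT
  have hz0 : z ≠ 0 := norm_ne_zero_iff.1 (by simp [hz])
  have hsign : ∀ y, inner ℝ (y - y₀) z = inner ℝ y z - supportFunction Ω₀ z := fun y => by
    rw [inner_sub_left, hsupp]
  have hhalfSpace : ∀ y ∈ slice A 0, inner ℝ (y - y₀) z ≤ 0 := fun y hy => by
    rw [hsign, sub_nonpos]
    exact inner_le_supportFunction hbdd z (hAΩ hy)
  have hhalfBall : ∀ y, ‖y - y₀‖ < r → inner ℝ (y - y₀) z < 0 → y ∈ slice A 0 := by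
    intro y hyr hyz
    rw [hsign, sub_neg] at hyz
    exact hΩA (hball ⟨mem_ball_iff_norm.2 hyr, hyz⟩)
  exact ⟨hA.1.mem_closure_slice hf hm hmα hr ht0 hI htr hz hhalfBall,
    notMem_interior_of_inner_nonpos hz0 fun x hx => hA.2.inner_nonpos_of_mem_slice
      (fun κ hκ => (hf κ hκ).1) ht0 hI (hbdd.closure.subset hAΩ) hhalfSpace hx⟩

theorem theorem10 (α : ℝ) (hα : 1 < α) :
    ∃ C : ℝ, 0 < C ∧
      ∀ (n : ℕ) (f : (Fin n → ℝ) → ℝ), CurvatureFlow.IsSpeedFunction f →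
      ∀ Ω₀ : Set (EuclideanSpace ℝ (Fin (n + 1))),
        IsOpen Ω₀ → Bornology.IsBounded Ω₀ → Convex ℝ Ω₀ →
      ∀ z y₀ : EuclideanSpace ℝ (Fin (n + 1)), ‖z‖ = 1 → y₀ ∈ frontier Ω₀ →
        inner ℝ y₀ z = CurvatureFlow.supportFunction Ω₀ z →
      ∀ r : ℝ, 0 < r →
        Metric.ball y₀ r ∩ {y | inner ℝ y z < CurvatureFlow.supportFunction Ω₀ z} ⊆ Ω₀ →
      ∀ (T : ℝ) (A : Set (EuclideanSpace ℝ (Fin (n + 1)) × ℝ)),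
        CurvatureFlow.IsBarrierSolution f α (Set.Icc 0 T) A →
        Ω₀ ⊆ CurvatureFlow.slice A 0 → CurvatureFlow.slice A 0 ⊆ closure Ω₀ →
      ∀ t : ℝ, 0 ≤ t → t ≤ T → t ≤ C * r ^ (1 + α) →
        y₀ ∈ frontier (CurvatureFlow.slice A t) := by
  obtain ⟨C, hC, hflat⟩ := theorem10_general α hα
  exact ⟨C, hC, fun n f hf Ω₀ _ hbdd _ z y₀ hz _ => hflat n f (fun _ => hf.mem_Icc) Ω₀ hbdd z y₀ hz⟩
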